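/- **Theorem (Sufficient Condition for Bifurcation).** Let $a\le b$ be real numbers, let $U\subseteq\mathbb R^k$ be open with $0\in U$, and let $f:[a,b]\times U\to\mathbb R^k$ be continuous with $f(\lambda,0)=0$ for every $\lambda\in[a,b]$. Assume that for every $\lambda\in[a,b]$ the map $x\mapsto f(\lambda,x)$ is (Fréchet) differentiable at $0$, with derivative $\partial_2 f(\lambda,0)$, and define $\varphi:[a,b]\to\mathbb R$ by $\varphi(\lambda)=\det(\partial_2 f(\lambda,0))$. A solution of the equation $f(\lambda,x)=0$ is a pair $(\lambda,x)\in[a,b]\times U$ that satisfies it; the solutions $(\lambda,0)$ are called trivial and all others nontrivial. A number $\lambda_0\in[a,b]$ is a *bifurcation point* if every neighborhood of $(\lambda_0,0)$ contains nontrivial solutions. The function $\varphi$ has a *sign-jump* at $\lambda_0\in[a,b]$ if every neighborhood of $\lambda_0$ contains points $s,t\in[a,b]$ with $s\le\lambda_0\le t$ and $\varphi(s)\varphi(t)<0$ (this holds in particular if $a<\lambda_0<b$ and $\varphi$ has constant, opposite, strict signs immediately to the left and immediately to the right of $\lambda_0$). 1. If $\varphi(a)\varphi(b)<0$, then $[a,b]$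 contains at least one bifurcation point. 2. If $\varphi$ has a sign-jump at some $\lambda_0\in[a,b]$, then $\lambda_0$ is a bifurcation point. -/

import Mathlib

open Set Topology

namespace Bifurcation

/-- The solutions `(l, x) ∈ J × U` of the equation `f (l, x) = 0`. -/
def solutions {k : ℕ} (J : Set ℝ) (U : Set (EuclideanSpace ℝ (Fin k)))
    (f : ℝ × EuclideanSpace ℝ (Fin k) → EuclideanSpace ℝ (Fin k)) :
    Set (ℝ × EuclideanSpace ℝ (Fin k)) :=
  {p | p ∈ J ×ˢ U ∧ f p = 0}

/-- The nontrivial solutions: those that are not of the form `(l, 0)` with `l ∈ J`. -/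
def nontrivialSolutions {k : ℕ} (J : Set ℝ) (U : Set (EuclideanSpace ℝ (Fin k)))
    (f : ℝ × EuclideanSpace ℝ (Fin k) → EuclideanSpace ℝ (Fin k)) :
    Set (ℝ × EuclideanSpace ℝ (Fin k)) :=
  solutions J U f \ (J ×ˢ {0})

/-- `l₀ ∈ J` is a bifurcation point of `f (l, x) = 0` on `J × U` if every neighborhood of
`(l₀, 0)` contains nontrivial solutions. -/
def IsBifurcationPoint {k : ℕ} (J : Set ℝ) (U : Set (EuclideanSpace ℝ (Fin k)))
    (f : ℝ × EuclideanSpace ℝ (Fin k) → EuclideanSpace ℝ (Fin k)) (l₀ : ℝ) : Prop :=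
  l₀ ∈ J ∧ ∀ N ∈ 𝓝 ((l₀, 0) : ℝ × EuclideanSpace ℝ (Fin k)),
    (N ∩ nontrivialSolutions J U f).Nonempty

/-- The determinant of the (Fréchet) partial derivative of `f` with respect to the second
variable at `(l, 0)`. -/
noncomputable def detPartial {k : ℕ}
    (f : ℝ × EuclideanSpace ℝ (Fin k) → EuclideanSpace ℝ (Fin k)) (l : ℝ) : ℝ :=
  (fderiv ℝ (fun x => f (l, x)) 0).det

/-- `φ : J → ℝ` has a sign-jump at `l₀`: every neighborhood of `l₀` contains points
`s ≤ l₀ ≤ t` of `J` at which the values of `φ` have opposite (strict) signs.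
No continuity of `φ` is required, and `l₀` may be an endpoint of `J`. When `φ` has constant
opposite strict signs immediately to the left and to the right of an interior point `l₀`,
this holds. -/
def HasSignJumpAt (J : Set ℝ) (φ : ℝ → ℝ) (l₀ : ℝ) : Prop :=
  ∀ N ∈ 𝓝 l₀, ∃ s ∈ N ∩ J, ∃ t ∈ N ∩ J, s ≤ l₀ ∧ l₀ ≤ t ∧ φ s * φ t < 0

end Bifurcation

namespace Bifurcation

/-! The sign of the determinant is a homotopy invariant, and without bifurcation the derivatives at
both ends would be homotopic. If no point of `[a, b]` bifurcates, compactness gives one ball in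
which `f (l, ·)` vanishes only at `0`, for all `l`. On its sphere, `f (a, ·)` deforms to `f (b, ·)`
without zeros, and each deforms to its invertible derivative.

The invariance is proved by Stokes' theorem instead of degree theory (`integral_comp_mul_det_eq`).
Let `F` be a smooth homotopy from `A` to `B` on `[0, 1] × [-1, 1]ᵏ` and `φ` a bump supported so near
`0` that `φ ∘ F` vanishes on the lateral faces. The pullback of `φ dy` is closed, so `det A · ∫ φ ∘
A = det B · ∫ φ ∘ B` with positive integrals. A sign-jump reduces to the first claim on small
intervals `[s, t]`. -/

/-- The determinant of `k` vectors in `Fin k → ℝ`, as a continuous alternating form. -/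
noncomputable def detForm (k : ℕ) : (Fin k → ℝ) [⋀^Fin k]→L[ℝ] ℝ :=
  { (Matrix.detRowAlternating : (Fin k → ℝ) [⋀^Fin k]→ₗ[ℝ] ℝ) with
    cont := by
      change Continuous fun M : Matrix (Fin k) (Fin k) ℝ => M.det
      exact continuous_id.matrix_det }

theorem detForm_apply_single {k : ℕ} (A : (Fin k → ℝ) →L[ℝ] (Fin k → ℝ)) :
    detForm k (fun j => A (Pi.single j 1)) = A.det := by
  have h : (LinearMap.toMatrix' (A : (Fin k → ℝ) →ₗ[ℝ] (Fin k → ℝ))).transpose =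
      Matrix.of fun j => A (Pi.single j 1) := by
    ext i j
    simp [LinearMap.toMatrix'_apply]
  rw [ContinuousLinearMap.det, ← LinearMap.det_toMatrix', ← Matrix.det_transpose, h]
  rfl

/-! ### Stokes' theorem on the cylinder over the cube -/

/-- Every top-degree form on `Fin k → ℝ` pulls back to a closed form. -/
theorem extDeriv_pullback_eq_zero {k : ℕ} {E : Type*} [NormedAddCommGroup E] [NormedSpace ℝ E]
    {ω : (Fin k → ℝ) → (Fin k → ℝ) [⋀^Fin k]→L[ℝ] ℝ} {F : E → Fin k → ℝ}
    (hω : Differentiable ℝ ω) (hF : ContDiff ℝ 2 F) (z : E) :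
    extDeriv (fun z => (ω (F z)).compContinuousLinearMap (fderiv ℝ F z)) z = 0 := by
  rw [extDeriv_pullback (r := 2) (hω _) hF.contDiffAt (by simp)]
  -- A form of degree `k + 1` vanishes because `k + 1` vectors in `ℝᵏ` are dependent.
  have : extDeriv ω (F z) = 0 := by
    ext v
    refine (extDeriv ω (F z)).toAlternatingMap.map_linearDependent v fun hv => ?_
    simpa using hv.fintype_card_le_finrank
  rw [this]
  rfl

theorem fderiv_apply_single_succ {k : ℕ} {F : (Fin (k + 1) → ℝ) → Fin k → ℝ}
    (hF : Differentiable ℝ F) {t : ℝ} {A : (Fin k → ℝ) →L[ℝ] (Fin k → ℝ)}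
    (hA : ∀ x, F (Fin.cons t x) = A x) (x : Fin k → ℝ) (j : Fin k) :
    fderiv ℝ F (Fin.cons t x) (Pi.single j.succ 1) = A (Pi.single j 1) := by
  have h1 : HasDerivAt (fun s : ℝ => (Fin.cons t x + s • Pi.single j.succ 1 : Fin (k + 1) → ℝ))
      (Pi.single j.succ 1) 0 := by
    simpa only [one_smul, id] using ((hasDerivAt_id (0 : ℝ)).smul_const
      (Pi.single j.succ 1 : Fin (k + 1) → ℝ)).const_add (Fin.cons t x)
  have h2 := (hF _).hasFDerivAt.comp_hasDerivAt (0 : ℝ) h1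
  have h3 : HasDerivAt (fun s : ℝ => A (x + s • Pi.single j 1)) (A (Pi.single j 1)) 0 := by
    have : HasDerivAt (fun s : ℝ => x + s • (Pi.single j 1 : Fin k → ℝ)) (Pi.single j 1) 0 := by
      simpa only [one_smul, id] using
        ((hasDerivAt_id (0 : ℝ)).smul_const (Pi.single j 1 : Fin k → ℝ)).const_add x
    exact A.hasFDerivAt.comp_hasDerivAt (0 : ℝ) this
  have h4 : F ∘ (fun s : ℝ => (Fin.cons t x + s • Pi.single j.succ 1 : Fin (k + 1) → ℝ)) =
      fun s : ℝ => A (x + s • Pi.single j 1) := by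
    funext s
    rw [← hA, Function.comp_apply]
    congr 1
    funext i
    refine Fin.cases ?_ (fun i => ?_) i
    · simp
    · simp [Pi.single_apply]
  rw [h4] at h2
  simpa using h2.unique h3

/-- If `φ ∘ F` vanishes on `[0, 1] × ∂[-1, 1]ᵏ`, then the integrals of the pullback of `φ dy`
along `F` over the two faces `{0} × [-1, 1]ᵏ` and `{1} × [-1, 1]ᵏ` agree. -/
theorem integral_comp_mul_det_eq {k : ℕ} {F : (Fin (k + 1) → ℝ) → Fin k → ℝ}
    (hF : ContDiff ℝ 2 F) {A B : (Fin k → ℝ) →L[ℝ] (Fin k → ℝ)}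
    (hA : ∀ x, F (Fin.cons 0 x) = A x) (hB : ∀ x, F (Fin.cons 1 x) = B x)
    {φ : (Fin k → ℝ) → ℝ} (hφ : Differentiable ℝ φ)
    (hside : ∀ t ∈ Icc (0 : ℝ) 1, ∀ x ∈ Icc (-1 : Fin k → ℝ) 1, ‖x‖ = 1 →
      φ (F (Fin.cons t x)) = 0) :
    ∫ x in Icc (-1 : Fin k → ℝ) 1, φ (A x) * A.det =
      ∫ x in Icc (-1 : Fin k → ℝ) 1, φ (B x) * B.det := by
  set ω : (Fin (k + 1) → ℝ) → (Fin (k + 1) → ℝ) [⋀^Fin k]→L[ℝ] ℝ := fun z =>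
    (φ (F z) • detForm k).compContinuousLinearMap (fderiv ℝ F z) with hω
  have hFd : Differentiable ℝ F := hF.differentiable (by norm_num)
  have hωd : Differentiable ℝ ω := by
    intro z
    refine DifferentiableAt.continuousAlternatingMapCompContinuousLinearMap ?_ ?_
    · exact ((hφ _).comp z (hFd z)).smul_const _
    · exact (hF.fderiv_right (m := 1) (by norm_num)).differentiable (by norm_num) z
  set e : Fin (k + 1) → Fin (k + 1) → ℝ := fun i => Pi.single i 1 with he
  -- The vector field dual to `ω`: its divergence is `dω` evaluated on the standard basis, hence
  -- zero.
  set V : Fin (k + 1) → (Fin (k + 1) → ℝ) → ℝ := fun i z =>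
    (-1) ^ (i : ℕ) • ω z (i.removeNth e) with hV
  have hWd : ∀ i : Fin (k + 1), Differentiable ℝ fun z => ω z (i.removeNth e) := fun i z =>
    (ContinuousAlternatingMap.apply ℝ _ ℝ (i.removeNth e)).differentiableAt.comp z (hωd z)
  have hVd : ∀ i, Differentiable ℝ (V i) := fun i => (hWd i).fun_const_smul _
  have hdiv : ∀ z, ∑ i, fderiv ℝ (V i) z (Pi.single i 1) = 0 := by
    intro z
    have h := extDeriv_apply (hωd z) e
    rw [hω, extDeriv_pullback_eq_zero (ω := fun y => φ y • detForm k)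
      (fun y => (hφ y).smul_const _) hF z] at h
    change 0 = _ at h
    rw [h]
    refine Finset.sum_congr rfl fun i _ => ?_
    rw [hV, fderiv_fun_const_smul (hWd i z)]
    rfl
  have key := MeasureTheory.integral_divergence_of_hasFDerivAt_off_countable'
    (Fin.cons 0 (-1)) (Fin.cons 1 1)
    (by
      intro i
      refine Fin.cases ?_ (fun i => ?_) i
      · simp
      · simp)
    V (fun i => fderiv ℝ (V i)) ∅ countable_empty
    (fun i => (hVd i).continuous.continuousOn) (fun x _ i => (hVd i x).hasFDerivAt)
    (by simp only [hdiv]; exact MeasureTheory.integrableOn_zero)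
  simp only [hdiv, MeasureTheory.integral_zero] at key
  have hc0 : (Fin.cons 0 (-1) : Fin (k + 1) → ℝ) ∘ Fin.succAbove 0 = (-1 : Fin k → ℝ) := by
    funext i; simp
  have hc1 : (Fin.cons 1 1 : Fin (k + 1) → ℝ) ∘ Fin.succAbove 0 = (1 : Fin k → ℝ) := by
    funext i; simp
  have hvan : ∀ (i : Fin k) (c : ℝ), |c| = 1 →
      ∫ x in Icc ((Fin.cons 0 (-1) : Fin (k + 1) → ℝ) ∘ Fin.succAbove i.succ)
        ((Fin.cons 1 1 : Fin (k + 1) → ℝ) ∘ Fin.succAbove i.succ),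
        V i.succ (i.succ.insertNth c x) = 0 := by
    intro i c hc
    refine MeasureTheory.setIntegral_eq_zero_of_forall_eq_zero fun x hx => ?_
    obtain ⟨t, y, hty⟩ : ∃ t : ℝ, ∃ y : Fin k → ℝ,
        (i.succ.insertNth c x : Fin (k + 1) → ℝ) = Fin.cons t y := ⟨_, _, (Fin.cons_self_tail _).symm⟩
    have hz : (i.succ.insertNth c x : Fin (k + 1) → ℝ) ∈
        Icc (Fin.cons 0 (-1) : Fin (k + 1) → ℝ) (Fin.cons 1 1) := by
      rw [Fin.insertNth_mem_Icc]
      have := abs_le.1 hc.le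
      exact ⟨by simpa using this, hx⟩
    have hyi : y i = c := by
      have := congrFun hty i.succ
      simpa using this.symm
    rw [hty] at hz
    have ht : t ∈ Icc (0 : ℝ) 1 := by simpa using And.intro (hz.1 0) (hz.2 0)
    have hy : y ∈ Icc (-1 : Fin k → ℝ) 1 :=
      ⟨fun j => by simpa using hz.1 j.succ, fun j => by simpa using hz.2 j.succ⟩
    have hn : ‖y‖ = 1 := by
      refine le_antisymm ((pi_norm_le_iff_of_nonneg zero_le_one).2 fun j => ?_) ?_
      · exact abs_le.2 ⟨hy.1 j, hy.2 j⟩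
      · calc (1 : ℝ) = ‖y i‖ := by rw [hyi, Real.norm_eq_abs, hc]
          _ ≤ ‖y‖ := norm_le_pi_norm y i
    rw [hty]
    simp [hV, hω, hside t ht y hy hn]
  have hface : ∀ (t : ℝ) (C : (Fin k → ℝ) →L[ℝ] (Fin k → ℝ)),
      (∀ x, F (Fin.cons t x) = C x) → ∀ x, V 0 (Fin.cons t x) = φ (C x) * C.det := by
    intro t C hC x
    simp only [hV, hω, Fin.val_zero, pow_zero, one_smul,
      ContinuousAlternatingMap.compContinuousLinearMap_apply, ContinuousAlternatingMap.smul_apply,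
      smul_eq_mul, hC]
    rw [← detForm_apply_single C]
    congr 2
    funext j
    exact fderiv_apply_single_succ hFd hC x j
  rw [Fin.sum_univ_succ] at key
  simp only [Fin.cons_zero, Fin.cons_succ, Pi.neg_apply, Pi.one_apply, hvan _ 1 (by simp),
    hvan _ (-1) (by simp), sub_zero, Finset.sum_const_zero, add_zero, hc0, hc1,
    Fin.insertNth_zero', hface 0 A hA, hface 1 B hB] at key
  linarith

/-- A bump of outer radius `δ` vanishes along the lateral faces, and its integrals along `A` and `B`
are positive. -/
theorem det_mul_det_nonneg_of_contDiff {k : ℕ} {F : (Fin (k + 1) → ℝ) → Fin k → ℝ}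
    (hF : ContDiff ℝ 2 F) {A B : (Fin k → ℝ) →L[ℝ] (Fin k → ℝ)}
    (hA : ∀ x, F (Fin.cons 0 x) = A x) (hB : ∀ x, F (Fin.cons 1 x) = B x)
    {δ : ℝ} (hδ : 0 < δ)
    (hside : ∀ t ∈ Icc (0 : ℝ) 1, ∀ x ∈ Icc (-1 : Fin k → ℝ) 1, ‖x‖ = 1 →
      δ ≤ ‖F (Fin.cons t x)‖) :
    0 ≤ A.det * B.det := by
  let φ : ContDiffBump (0 : Fin k → ℝ) := ⟨δ / 2, δ, by positivity, by linarith⟩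
  have h := integral_comp_mul_det_eq hF hA hB (φ := φ)
    ((φ.contDiff (n := 1)).differentiable (by norm_num))
    (fun t ht x hx hn => φ.zero_of_le_dist (by simpa using hside t ht x hx hn))
  have hpos : ∀ C : (Fin k → ℝ) →L[ℝ] (Fin k → ℝ),
      0 < ∫ x in Icc (-1 : Fin k → ℝ) 1, φ (C x) := by
    intro C
    have hc : Continuous fun x => φ (C x) := φ.continuous.comp C.continuous
    rw [MeasureTheory.setIntegral_pos_iff_support_of_nonneg_ae
      (Filter.Eventually.of_forall fun x => φ.nonneg)
      (hc.continuousOn.integrableOn_compact isCompact_Icc)]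
    have hn : (Function.support fun x => φ (C x)) ∩ Icc (-1 : Fin k → ℝ) 1 ∈
        𝓝 (0 : Fin k → ℝ) := by
      refine Filter.inter_mem ((isOpen_ne_fun hc continuous_const).mem_nhds ?_) ?_
      · simp only [mem_ofPred_eq, map_zero]
        exact (φ.pos_of_mem_ball (by simpa using φ.rOut_pos)).ne'
      · rw [← Set.pi_univ_Icc]
        exact set_pi_mem_nhds finite_univ fun i _ => Icc_mem_nhds (by simp) (by simp)
    exact MeasureTheory.Measure.measure_pos_of_mem_nhds _ hn
  rw [MeasureTheory.integral_mul_const, MeasureTheory.integral_mul_const] at h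
  have hA' := hpos A
  have hB' := hpos B
  by_contra! hneg
  have : (∫ x in Icc (-1 : Fin k → ℝ) 1, φ (A x)) * (A.det * A.det) =
      (∫ x in Icc (-1 : Fin k → ℝ) 1, φ (B x)) * (A.det * B.det) := by
    linear_combination A.det * h
  nlinarith [mul_nonneg hA'.le (mul_self_nonneg A.det), mul_neg_of_pos_of_neg hB' hneg]

/-! ### Homotopies without zeros on the sphere -/

/-- Maps on the unit ball of `Fin k → ℝ` without zeros on the unit sphere. -/
def SphereNonvanishing {k : ℕ} (g : C(Metric.closedBall (0 : Fin k → ℝ) 1, Fin k → ℝ)) : Prop :=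
  ∀ x : Metric.closedBall (0 : Fin k → ℝ) 1, ‖(x : Fin k → ℝ)‖ = 1 → g x ≠ 0

/-- The restriction of a continuous linear map to the unit ball. -/
def linearOnBall {k : ℕ} (A : (Fin k → ℝ) →L[ℝ] (Fin k → ℝ)) :
    C(Metric.closedBall (0 : Fin k → ℝ) 1, Fin k → ℝ) :=
  ⟨fun x => A x, by fun_prop⟩

/-- The sup norm makes the ball of the homotopies the box of the divergence theorem. -/
theorem mem_closedBall_iff_mem_Icc {k : ℕ} {x : Fin k → ℝ} :
    x ∈ Metric.closedBall (0 : Fin k → ℝ) 1 ↔ x ∈ Icc (-1 : Fin k → ℝ) 1 := by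
  rw [mem_closedBall_zero_iff, pi_norm_le_iff_of_nonneg zero_le_one]
  simp only [Real.norm_eq_abs, abs_le, mem_Icc, Pi.le_def, Pi.neg_apply, Pi.one_apply,
    forall_and]

/-- A continuous homotopy is extended by Tietze and smoothed; a correction then restores its linear
ends. -/
theorem det_mul_det_nonneg_of_homotopicWith {k : ℕ} {A B : (Fin k → ℝ) →L[ℝ] (Fin k → ℝ)}
    (h : ContinuousMap.HomotopicWith (linearOnBall A) (linearOnBall B) SphereNonvanishing) :
    0 ≤ A.det * B.det := by
  obtain ⟨H⟩ := h
  obtain ⟨δ, hδ, hHδ⟩ : ∃ δ > 0, ∀ t (x : Metric.closedBall (0 : Fin k → ℝ) 1),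
      ‖(x : Fin k → ℝ)‖ = 1 → δ ≤ ‖H (t, x)‖ := by
    have hK : IsCompact {p : unitInterval × Metric.closedBall (0 : Fin k → ℝ) 1 |
        ‖(p.2 : Fin k → ℝ)‖ = 1} :=
      (isClosed_eq (by fun_prop) continuous_const).isCompact
    obtain ⟨δ, hδ, h⟩ := hK.exists_forall_le' (f := fun p => ‖H p‖) (a := 0)
      (by exact (map_continuous H).norm.continuousOn)
      (fun p hp => norm_pos_iff.2 (H.prop p.1 p.2 hp))
    exact ⟨δ, hδ, fun t x hx => h (t, x) hx⟩
  let e : unitInterval × Metric.closedBall (0 : Fin k → ℝ) 1 → Fin (k + 1) → ℝ :=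
    fun p => Fin.cons (p.1 : ℝ) (p.2 : Fin k → ℝ)
  have he : IsClosedEmbedding e := by
    refine Continuous.isClosedEmbedding ?_ ?_
    · refine continuous_pi fun i => ?_
      refine Fin.cases ?_ (fun i => ?_) i
      · simp only [e, Fin.cons_zero]; fun_prop
      · simp only [e, Fin.cons_succ]
        exact (continuous_apply i).comp (by fun_prop)
    · rintro ⟨s, x⟩ ⟨t, y⟩ h
      obtain ⟨h1, h2⟩ := Fin.cons_inj.1 h
      exact Prod.ext (Subtype.ext h1) (Subtype.ext h2)
  obtain ⟨G, hG⟩ := ContinuousMap.exists_extension he (H : C(_, Fin k → ℝ))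
  have hGH : ∀ t (ht : t ∈ Icc (0 : ℝ) 1) x (hx : x ∈ Metric.closedBall (0 : Fin k → ℝ) 1),
      G (Fin.cons t x) = H (⟨t, ht⟩, ⟨x, hx⟩) := fun t ht x hx =>
    DFunLike.congr_fun hG ((⟨t, ht⟩, ⟨x, hx⟩) : unitInterval × Metric.closedBall (0 : Fin k → ℝ) 1)
  obtain ⟨P, hP, hPG, -⟩ := G.continuous.exists_contDiff_approx 2
    (continuous_const (y := δ / 4)) (fun _ => by positivity)
  let T : (Fin (k + 1) → ℝ) → Fin k → ℝ := Fin.tail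
  have hT : ContDiff ℝ 2 T := contDiff_pi.2 fun i => contDiff_apply _ _ i.succ
  have hcons : ∀ t : ℝ, ContDiff ℝ 2 fun z => (Fin.cons t (T z) : Fin (k + 1) → ℝ) := by
    intro t
    refine contDiff_pi.2 fun i => ?_
    refine Fin.cases ?_ (fun i => ?_) i
    · simpa using contDiff_const
    · simpa using contDiff_pi.1 hT i
  -- Interpolating the two end errors makes the ends exactly `A` and `B`. Smoothing and correction
  -- each cost at most `δ / 4`, which leaves `δ / 2` on the sphere.
  let F : (Fin (k + 1) → ℝ) → Fin k → ℝ := fun z =>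
    P z + ((1 - z 0) • (A (T z) - P (Fin.cons 0 (T z))) +
      z 0 • (B (T z) - P (Fin.cons 1 (T z))))
  have hz0 : ContDiff ℝ 2 fun z : Fin (k + 1) → ℝ => z 0 := contDiff_apply _ _ 0
  have hF : ContDiff ℝ 2 F :=
    hP.add (((contDiff_const.sub hz0).smul ((A.contDiff.comp hT).sub (hP.comp (hcons 0)))).add
      (hz0.smul ((B.contDiff.comp hT).sub (hP.comp (hcons 1)))))
  refine det_mul_det_nonneg_of_contDiff hF (A := A) (B := B) (δ := δ / 2) ?_ ?_ (by positivity) ?_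
  · intro x
    simp [F, T]
  · intro x
    simp [F, T]
  · intro t ht x hx hn
    have hx' := mem_closedBall_iff_mem_Icc.2 hx
    have h0 : ‖A x - P (Fin.cons 0 x)‖ ≤ δ / 4 := by
      have h1 := hPG (Fin.cons 0 x)
      rw [hGH 0 (by simp) x hx', dist_comm, dist_eq_norm] at h1
      have : H (⟨0, by simp⟩, ⟨x, hx'⟩) = A x := H.apply_zero ⟨x, hx'⟩
      rw [this] at h1
      exact h1.le
    have h1 : ‖B x - P (Fin.cons 1 x)‖ ≤ δ / 4 := by
      have h1 := hPG (Fin.cons 1 x)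
      rw [hGH 1 (by simp) x hx', dist_comm, dist_eq_norm] at h1
      have : H (⟨1, by simp⟩, ⟨x, hx'⟩) = B x := H.apply_one ⟨x, hx'⟩
      rw [this] at h1
      exact h1.le
    have h2 : ‖H (⟨t, ht⟩, ⟨x, hx'⟩) - P (Fin.cons t x)‖ ≤ δ / 4 := by
      have h1 := hPG (Fin.cons t x)
      rw [hGH t ht x hx', dist_comm, dist_eq_norm] at h1
      exact h1.le
    have h3 : ‖(1 - t) • (A x - P (Fin.cons 0 x)) + t • (B x - P (Fin.cons 1 x))‖ ≤ δ / 4 := by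
      refine (norm_add_le _ _).trans ?_
      rw [norm_smul, norm_smul, Real.norm_of_nonneg ht.1, Real.norm_of_nonneg (sub_nonneg.2 ht.2)]
      nlinarith [mul_le_mul_of_nonneg_left h0 (sub_nonneg.2 ht.2),
        mul_le_mul_of_nonneg_left h1 ht.1]
    have h4 : H (⟨t, ht⟩, ⟨x, hx'⟩) = F (Fin.cons t x) + ((H (⟨t, ht⟩, ⟨x, hx'⟩) - P (Fin.cons t x)) -
        ((1 - t) • (A x - P (Fin.cons 0 x)) + t • (B x - P (Fin.cons 1 x)))) := by
      simp only [F, T, Fin.cons_zero, Fin.tail_cons]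
      abel
    have h5 := hHδ ⟨t, ht⟩ ⟨x, hx'⟩ hn
    have h6 : ‖H (⟨t, ht⟩, ⟨x, hx'⟩)‖ ≤ ‖F (Fin.cons t x)‖ + (δ / 4 + δ / 4) := by
      conv_lhs => rw [h4]
      exact (norm_add_le _ _).trans
        (add_le_add_right ((norm_sub_le _ _).trans (add_le_add h2 h3)) _)
    linarith

/-- A map without zeros in a punctured ball around its zero `0` is, after rescaling, homotopic to
its derivative at `0` through maps without zeros on the unit sphere. -/
theorem homotopicWith_fderiv {k : ℕ} {g : (Fin k → ℝ) → Fin k → ℝ}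
    {A : (Fin k → ℝ) →L[ℝ] (Fin k → ℝ)} {r : ℝ} (hr : 0 < r)
    (hg : ContinuousOn g (Metric.closedBall 0 r)) (hg0 : g 0 = 0) (hA : HasFDerivAt g A 0)
    (hdet : A.det ≠ 0) (hne : ∀ x ∈ Metric.closedBall (0 : Fin k → ℝ) r, x ≠ 0 → g x ≠ 0)
    (G : C(Metric.closedBall (0 : Fin k → ℝ) 1, Fin k → ℝ)) (hG : ∀ x, G x = r⁻¹ • g (r • x)) :
    ContinuousMap.HomotopicWith (linearOnBall A) G SphereNonvanishing := by
  have hmem : ∀ p : unitInterval × Metric.closedBall (0 : Fin k → ℝ) 1,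
      ((p.1 * r : ℝ) • (p.2 : Fin k → ℝ)) ∈ Metric.closedBall (0 : Fin k → ℝ) r := by
    rintro ⟨s, x⟩
    have hx : ‖(x : Fin k → ℝ)‖ ≤ 1 := mem_closedBall_zero_iff.1 x.2
    rw [mem_closedBall_zero_iff, norm_smul, norm_mul, Real.norm_of_nonneg s.2.1,
      Real.norm_of_nonneg hr.le]
    have h1 := mul_le_mul s.2.2 hx (norm_nonneg _) zero_le_one
    nlinarith
  -- For `s ≠ 0` this is `g (s r x) / (s r)`. Since `0⁻¹ = 0`, it equals `A x` at `s = 0`, where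
  -- continuity is differentiability of `g` at `0`.
  let H : unitInterval × Metric.closedBall (0 : Fin k → ℝ) 1 → Fin k → ℝ := fun p =>
    A p.2 + (p.1 * r : ℝ)⁻¹ • (g ((p.1 * r : ℝ) • (p.2 : Fin k → ℝ)) -
      A ((p.1 * r : ℝ) • (p.2 : Fin k → ℝ)))
  have hH : ∀ p, (p.1 : ℝ) ≠ 0 → H p = (p.1 * r : ℝ)⁻¹ • g ((p.1 * r : ℝ) • (p.2 : Fin k → ℝ)) := by
    intro p hp
    have : (p.1 * r : ℝ) ≠ 0 := mul_ne_zero hp hr.ne'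
    simp only [H, map_smul, smul_sub, inv_smul_smul₀ this]
    abel
  have hcont : Continuous H := by
    have hA2 : Continuous fun p : unitInterval × Metric.closedBall (0 : Fin k → ℝ) 1 =>
        A p.2 := by fun_prop
    refine hA2.add (continuous_iff_continuousAt.2 fun p => ?_)
    have harg : Continuous fun p : unitInterval × Metric.closedBall (0 : Fin k → ℝ) 1 =>
        (p.1 * r : ℝ) • (p.2 : Fin k → ℝ) := by fun_prop
    by_cases hp : (p.1 : ℝ) = 0
    · rw [Metric.continuousAt_iff']
      intro ε hε
      have ho := hA.isLittleO.def (half_pos hε)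
      simp only [sub_zero, hg0] at ho
      have ht : Filter.Tendsto (fun p : unitInterval × Metric.closedBall (0 : Fin k → ℝ) 1 =>
          (p.1 * r : ℝ) • (p.2 : Fin k → ℝ)) (𝓝 p) (𝓝 0) := by
        have := harg.tendsto p
        simpa [hp] using this
      filter_upwards [ht.eventually ho] with q hq
      have hx : ‖(q.2 : Fin k → ℝ)‖ ≤ 1 := mem_closedBall_zero_iff.1 q.2.2
      simp only [hp, zero_mul, inv_zero, zero_smul, dist_zero_right]
      rw [norm_smul, norm_inv]
      rw [norm_smul] at hq
      rcases eq_or_ne (q.1 * r : ℝ) 0 with h0 | h0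
      · simp [h0, hε]
      · have hpos : 0 < ‖(q.1 * r : ℝ)‖ := norm_pos_iff.2 h0
        rw [inv_mul_lt_iff₀ hpos]
        nlinarith [mul_le_mul_of_nonneg_left hx hpos.le, mul_pos hpos hε]
    · have hg' : Continuous fun p : unitInterval × Metric.closedBall (0 : Fin k → ℝ) 1 =>
          g ((p.1 * r : ℝ) • (p.2 : Fin k → ℝ)) - A ((p.1 * r : ℝ) • (p.2 : Fin k → ℝ)) :=
        (hg.comp_continuous harg hmem).sub (A.continuous.comp harg)
      have hinv : ContinuousAt (fun p : unitInterval × Metric.closedBall (0 : Fin k → ℝ) 1 =>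
          (p.1 * r : ℝ)⁻¹) p :=
        ContinuousAt.inv₀ (by fun_prop) (mul_ne_zero hp hr.ne')
      exact hinv.smul hg'.continuousAt
  refine ⟨⟨⟨⟨H, hcont⟩, ?_, ?_⟩, ?_⟩⟩
  · intro x
    simp [H, linearOnBall]
  · intro x
    simp [hH, hG]
  · intro t x hx h0
    have hx0 : (x : Fin k → ℝ) ≠ 0 := by
      intro h
      simp [h] at hx
    change H (t, x) = 0 at h0
    by_cases ht : (t : ℝ) = 0
    · have : A x = 0 := by simpa [H, ht] using h0
      refine hx0 ((LinearMap.equivOfDetNeZero (A : (Fin k → ℝ) →ₗ[ℝ] (Fin k → ℝ))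
        hdet).map_eq_zero_iff.1 ?_)
      exact this
    · have htr : (t * r : ℝ) ≠ 0 := mul_ne_zero ht hr.ne'
      rw [hH _ ht] at h0
      exact hne _ (hmem (t, x)) (smul_ne_zero htr hx0)
        ((smul_eq_zero.1 h0).resolve_left (inv_ne_zero htr))

/-! ### From absence of bifurcation to the sign of the determinants -/

theorem det_mul_det_nonneg_of_forall_ne_zero {k : ℕ} {a b r : ℝ} (hab : a ≤ b) (hr : 0 < r)
    {f : ℝ × (Fin k → ℝ) → Fin k → ℝ}
    (hf : ContinuousOn f (Icc a b ×ˢ Metric.closedBall 0 r))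
    (hf0 : ∀ l ∈ Icc a b, f (l, 0) = 0) {A B : (Fin k → ℝ) →L[ℝ] (Fin k → ℝ)}
    (hA : HasFDerivAt (fun x => f (a, x)) A 0) (hB : HasFDerivAt (fun x => f (b, x)) B 0)
    (hne : ∀ l ∈ Icc a b, ∀ x ∈ Metric.closedBall (0 : Fin k → ℝ) r, x ≠ 0 → f (l, x) ≠ 0) :
    0 ≤ A.det * B.det := by
  by_contra! hneg
  have hdA : A.det ≠ 0 := by rintro h; simp [h] at hneg
  have hdB : B.det ≠ 0 := by rintro h; simp [h] at hneg
  have hmem : ∀ x : Metric.closedBall (0 : Fin k → ℝ) 1,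
      r • (x : Fin k → ℝ) ∈ Metric.closedBall (0 : Fin k → ℝ) r := by
    intro x
    have hx : ‖(x : Fin k → ℝ)‖ ≤ 1 := mem_closedBall_zero_iff.1 x.2
    rw [mem_closedBall_zero_iff, norm_smul, Real.norm_of_nonneg hr.le]
    nlinarith
  have hslice : ∀ l ∈ Icc a b, ContinuousOn (fun x => f (l, x)) (Metric.closedBall 0 r) :=
    fun l hl => hf.comp (by fun_prop) fun x hx => ⟨hl, hx⟩
  let c : unitInterval → ℝ := fun t => a + t * (b - a)
  have hc : ∀ t, c t ∈ Icc a b := fun t =>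
    ⟨by nlinarith [mul_nonneg t.2.1 (sub_nonneg.2 hab)],
      by nlinarith [mul_le_mul_of_nonneg_right t.2.2 (sub_nonneg.2 hab)]⟩
  let g : ∀ l ∈ Icc a b, C(Metric.closedBall (0 : Fin k → ℝ) 1, Fin k → ℝ) := fun l hl =>
    ⟨fun x => r⁻¹ • f (l, r • (x : Fin k → ℝ)),
      ((hslice l hl).comp_continuous (by fun_prop) hmem).fun_const_smul _⟩
  have hgA := homotopicWith_fderiv hr (hslice a (left_mem_Icc.2 hab))
    (hf0 a (left_mem_Icc.2 hab)) hA hdA (hne a (left_mem_Icc.2 hab))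
    (g a (left_mem_Icc.2 hab)) (fun _ => rfl)
  have hgB := homotopicWith_fderiv hr (hslice b (right_mem_Icc.2 hab))
    (hf0 b (right_mem_Icc.2 hab)) hB hdB (hne b (right_mem_Icc.2 hab))
    (g b (right_mem_Icc.2 hab)) (fun _ => rfl)
  have hgg : ContinuousMap.HomotopicWith (g a (left_mem_Icc.2 hab)) (g b (right_mem_Icc.2 hab))
      SphereNonvanishing := by
    refine ⟨⟨⟨⟨fun p => r⁻¹ • f (c p.1, r • (p.2 : Fin k → ℝ)), ?_⟩, ?_, ?_⟩, ?_⟩⟩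
    · refine (hf.comp_continuous ?_ fun p => ⟨hc p.1, hmem p.2⟩).fun_const_smul _
      simp only [c]
      fun_prop
    · intro x
      simp [g, c]
    · intro x
      simp [g, c]
    · intro t x hx h0
      have hx0 : (x : Fin k → ℝ) ≠ 0 := by
        intro h
        simp [h] at hx
      exact hne _ (hc t) _ (hmem x) (smul_ne_zero hr.ne' hx0)
        ((smul_eq_zero.1 h0).resolve_left (inv_ne_zero hr.ne'))
  exact absurd (det_mul_det_nonneg_of_homotopicWith ((hgA.trans hgg).trans hgB.symm)) hneg.not_ge

theorem exists_isBifurcationPoint {k : ℕ} {a b : ℝ} (hab : a ≤ b)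
    {U : Set (EuclideanSpace ℝ (Fin k))} (hU : IsOpen U) (h0U : 0 ∈ U)
    {f : ℝ × EuclideanSpace ℝ (Fin k) → EuclideanSpace ℝ (Fin k)}
    (hf : ContinuousOn f (Icc a b ×ˢ U)) (hf0 : ∀ l ∈ Icc a b, f (l, 0) = 0)
    (hdiff : ∀ l ∈ Icc a b, DifferentiableAt ℝ (fun x => f (l, x)) 0)
    (hdet : detPartial f a * detPartial f b < 0) :
    ∃ l₀ ∈ Icc a b, IsBifurcationPoint (Icc a b) U f l₀ := by
  by_contra! hbif
  set S := nontrivialSolutions (Icc a b) U f with hS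
  have hsub : Icc a b ×ˢ {0} ⊆ (closure S)ᶜ ∩ univ ×ˢ U := by
    rintro ⟨l, x⟩ ⟨hl, rfl : x = 0⟩
    refine ⟨fun hcl => hbif l hl ⟨hl, fun N hN => ?_⟩, trivial, h0U⟩
    exact mem_closure_iff_nhds.1 hcl N hN
  -- The tube lemma makes the zero-free neighborhood uniform in `l`.
  obtain ⟨u, v, -, hv, hu, h0v, huv⟩ := generalized_tube_lemma isCompact_Icc isCompact_singleton
    (isClosed_closure.isOpen_compl.inter (isOpen_univ.prod hU)) hsub
  -- Passing to the sup norm conjugates the derivatives, which preserves determinants.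
  let e := PiLp.continuousLinearEquiv 2 ℝ (fun _ : Fin k => ℝ)
  have hev : e.symm ⁻¹' v ∈ 𝓝 (0 : Fin k → ℝ) :=
    e.symm.continuous.continuousAt.preimage_mem_nhds
      (by rw [map_zero]; exact hv.mem_nhds (h0v rfl))
  obtain ⟨r, hr, hrv⟩ := Metric.nhds_basis_closedBall.mem_iff.1 hev
  have hmem : ∀ l ∈ Icc a b, ∀ x ∈ Metric.closedBall (0 : Fin k → ℝ) r,
      e.symm x ∈ U ∧ (l, e.symm x) ∉ S := fun l hl x hx =>
    have h := huv ⟨hu hl, hrv hx⟩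
    ⟨h.2.2, fun hS => h.1 (subset_closure hS)⟩
  let D : ℝ → EuclideanSpace ℝ (Fin k) →L[ℝ] EuclideanSpace ℝ (Fin k) :=
    fun l => fderiv ℝ (fun x => f (l, x)) 0
  have hder : ∀ l ∈ Icc a b, HasFDerivAt (fun x => e (f (l, e.symm x)))
      ((e : EuclideanSpace ℝ (Fin k) →L[ℝ] Fin k → ℝ) ∘L D l ∘L
        (e.symm : (Fin k → ℝ) →L[ℝ] EuclideanSpace ℝ (Fin k))) 0 := by
    intro l hl
    have h1 : HasFDerivAt (fun x => f (l, x)) (D l) (e.symm 0) := by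
      rw [map_zero]
      exact (hdiff l hl).hasFDerivAt
    exact e.hasFDerivAt.comp 0 (h1.comp 0 e.symm.hasFDerivAt)
  have hconj : ∀ l, ((e : EuclideanSpace ℝ (Fin k) →L[ℝ] Fin k → ℝ) ∘L D l ∘L
      (e.symm : (Fin k → ℝ) →L[ℝ] EuclideanSpace ℝ (Fin k))).det = detPartial f l := fun l =>
    LinearMap.det_conj (D l : EuclideanSpace ℝ (Fin k) →ₗ[ℝ] EuclideanSpace ℝ (Fin k))
      e.toLinearEquiv
  have hcont : ContinuousOn (fun p : ℝ × (Fin k → ℝ) => e (f (p.1, e.symm p.2)))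
      (Icc a b ×ˢ Metric.closedBall 0 r) :=
    e.continuous.comp_continuousOn (hf.comp
      (continuous_fst.prodMk (e.symm.continuous.comp continuous_snd)).continuousOn
      fun p hp => ⟨hp.1, (hmem p.1 hp.1 p.2 hp.2).1⟩)
  have h := det_mul_det_nonneg_of_forall_ne_zero hab hr hcont
    (fun l hl => by simp [hf0 l hl]) (hder a (left_mem_Icc.2 hab)) (hder b (right_mem_Icc.2 hab))
    (fun l hl x hx hx0 h0 => (hmem l hl x hx).2
      ⟨⟨⟨hl, (hmem l hl x hx).1⟩, by simpa using h0⟩, fun hm => hx0 (by simpa using hm.2)⟩)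
  rw [hconj, hconj] at h
  exact h.not_gt hdet

end Bifurcation

theorem mainTheorem10 {k : ℕ} (a b : ℝ) (hab : a ≤ b)
    (U : Set (EuclideanSpace ℝ (Fin k))) (hU : IsOpen U) (h0U : 0 ∈ U)
    (f : ℝ × EuclideanSpace ℝ (Fin k) → EuclideanSpace ℝ (Fin k))
    (hf : ContinuousOn f (Set.Icc a b ×ˢ U))
    (hf0 : ∀ l ∈ Set.Icc a b, f (l, 0) = 0)
    (hdiff : ∀ l ∈ Set.Icc a b, DifferentiableAt ℝ (fun x => f (l, x)) 0) :
    (Bifurcation.detPartial f a * Bifurcation.detPartial f b < 0 →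
      ∃ l₀ ∈ Set.Icc a b, Bifurcation.IsBifurcationPoint (Set.Icc a b) U f l₀) ∧
    (∀ l₀ ∈ Set.Icc a b,
      Bifurcation.HasSignJumpAt (Set.Icc a b) (Bifurcation.detPartial f) l₀ →
        Bifurcation.IsBifurcationPoint (Set.Icc a b) U f l₀) := by
  refine ⟨Bifurcation.exists_isBifurcationPoint hab hU h0U hf hf0 hdiff, ?_⟩
  intro l₀ hl₀ hjump
  refine ⟨hl₀, fun N hN => ?_⟩
  have h1 : ∀ᶠ l in 𝓝 l₀, N ∈ 𝓝 ((l, 0) : ℝ × EuclideanSpace ℝ (Fin k)) :=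
    (Continuous.prodMk_left (0 : EuclideanSpace ℝ (Fin k))).continuousAt.eventually
      (eventually_eventually_nhds.2 hN)
  obtain ⟨ε, hε, hball⟩ := Metric.nhds_basis_ball.mem_iff.1 h1
  obtain ⟨s, hs, t, ht, hsl, hlt, hst⟩ := hjump _ (Metric.ball_mem_nhds l₀ hε)
  have hsub : Icc s t ⊆ Icc a b := Icc_subset_Icc hs.2.1 ht.2.2
  -- This `l` may differ from `l₀`, but `N` is also a neighborhood of `(l, 0)`.
  obtain ⟨l, hl, -, hbif⟩ := Bifurcation.exists_isBifurcationPoint (hsl.trans hlt) hU h0U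
    (hf.mono (prod_mono_left hsub)) (fun l hl => hf0 l (hsub hl)) (fun l hl => hdiff l (hsub hl)) hst
  have hlb : l ∈ Metric.ball l₀ ε := by
    have h2 := hs.1
    have h3 := ht.1
    rw [Real.ball_eq_Ioo] at h2 h3 ⊢
    exact ⟨h2.1.trans_le hl.1, hl.2.trans_lt h3.2⟩
  obtain ⟨p, hpN, hp, hp0⟩ := hbif N (hball hlb)
  exact ⟨p, hpN, ⟨⟨hsub hp.1.1, hp.1.2⟩, hp.2⟩, fun h => hp0 ⟨hp.1.1, h.2⟩⟩
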